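/- Let $M,N\ge 3$ be integers and let $x\in\{-1,1\}^N$, $y\in\{-1,1\}^M$, indexed by $\mathbb Z/N\mathbb Z$ and $\mathbb Z/M\mathbb Z$. The toroidal Hitomezashi pattern $C_{M,N}(x,y)$ is the oriented graph with vertex set $\mathbb Z/M\mathbb Z\times\mathbb Z/N\mathbb Z$ in which the edge $\{(i,j),(i+1,j)\}$ is oriented $(i,j)\to(i+1,j)$ if $x_j=1$ and $(i+1,j)\to(i,j)$ if $x_j=-1$, and the edge $\{(i,j),(i,j+1)\}$ is oriented $(i,j)\to(i,j+1)$ if $y_i=1$ and $(i,j+1)\to(i,j)$ if $y_i=-1$. A loop of the pattern is a circuit of this oriented graph (a closed directed walk of positive length that repeats no edge, but may repeat vertices) whose edges alternate cyclically between horizontal and vertical ones. If $\Delta x$ is the number of its edges of the form $(i,j)\to(i+1,j)$ minus the number of its edges of the form $(i+1,j)\to(i,j)$, and $\Delta y$ is the number of its edges $(i,j)\to(i,j+1)$ minus the number of its edges $(i,j+1)\to(i,j)$, then the homology class of the loop is $(\Delta x/M,\Delta y/N)$; the loop is nontrivial if its class is not $(0,0)$. For a binary string $z$ let $k(z)$ be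 the number of $1$'s minus the number of $(-1)$'s in $z$. **Theorem 1 (Homology class).** (1) In a symmetric pattern $C_{N,N}(x,x)$, every nontrivial loop has homology class $(1,1)$ if $k(x)>0$ and $(-1,-1)$ if $k(x)<0$; if $k(x)=0$, there is no nontrivial loop. (2) In a general pattern $C_{M,N}(x,y)$, the possible homology classes of nontrivial loops are as follows. - If $k(x)\ne0$ and $k(y)\ne0$, the set of homology classes of the nontrivial loops is exactly $\{(k(x)/g,\,k(y)/g)\}$, where $g=\gcd(|k(x)|,|k(y)|)$; in particular there is a nontrivial loop. - If $k(x)=0$ and $k(y)\neq0$, every nontrivial loop has class $(0,1)$ or $(0,-1)$. - If $k(x)\ne0$ and $k(y)=0$, every nontrivial loop has class $(1,0)$ or $(-1,0)$. - If $k(x)=k(y)=0$, every nontrivial loop has class $(0,1)$, $(0,-1)$, $(1,0)$ or $(-1,0)$. All these classes are indeed possible: in the second case there is a pattern (for some $M,N$) whose set of classes of nontrivial loops is exactly $\{(0,1),(0,-1)\}$; in the third case there is one with set $\{(1,0),(-1,0)\}$; and in the fourth case there are patterns with each of these two sets. -/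

import Mathlib

namespace Hitomezashi

/-- The graph `C_{M,N}` has vertex set `ℤ/Mℤ × ℤ/Nℤ`. -/
abbrev Vertex (M N : ℕ) : Type := ZMod M × ZMod N

/-- A binary string in `{-1, 1}^n`, with cyclic index set; `ℤˣ` is the set `{1, -1}`. -/
abbrev BinaryString (n : ℕ) : Type := ZMod n → ℤˣ

/-- `k(x)`: the number of `1`'s minus the number of `(-1)`'s in `x`. -/
noncomputable def k {n : ℕ} (x : BinaryString n) : ℤ :=
  ({j | x j = 1}.ncard : ℤ) - ({j | x j = -1}.ncard : ℤ)

/-- `v → w` is of the form `(i, j) → (i + 1, j)`. -/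
def IsRight {M N : ℕ} (v w : Vertex M N) : Prop := w = (v.1 + 1, v.2)

/-- `v → w` is of the form `(i + 1, j) → (i, j)`. -/
def IsLeft {M N : ℕ} (v w : Vertex M N) : Prop := v = (w.1 + 1, w.2)

/-- `v → w` is of the form `(i, j) → (i, j + 1)`. -/
def IsUp {M N : ℕ} (v w : Vertex M N) : Prop := w = (v.1, v.2 + 1)

/-- `v → w` is of the form `(i, j + 1) → (i, j)`. -/
def IsDown {M N : ℕ} (v w : Vertex M N) : Prop := v = (w.1, w.2 + 1)

/-- `v` and `w` are the two ends of a horizontal edge. -/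
def IsHorizontal {M N : ℕ} (v w : Vertex M N) : Prop := IsRight v w ∨ IsLeft v w

/-- `v` and `w` are the two ends of a vertical edge. -/
def IsVertical {M N : ℕ} (v w : Vertex M N) : Prop := IsUp v w ∨ IsDown v w

/-- The toroidal Hitomezashi pattern `C_{M,N}(x, y)`, as an oriented graph: the edges on the
horizontal line of ordinate `j` point to the right if `x j = 1` and to the left if `x j = -1`, the
edges on the vertical line of abscissa `i` point up if `y i = 1` and down if `y i = -1`. -/
def pattern {M N : ℕ} (x : BinaryString N) (y : BinaryString M) : Digraph (Vertex M N) where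
  Adj v w :=
    (IsRight v w ∧ x v.2 = 1) ∨ (IsLeft v w ∧ x v.2 = -1) ∨
    (IsUp v w ∧ y v.1 = 1) ∨ (IsDown v w ∧ y v.1 = -1)

/-- A toroidal Hitomezashi loop: a circuit (a closed directed walk of positive length, without
repeated edges; vertices may be repeated) in the oriented graph `C_{M,N}(x, y)` whose edges
alternate, cyclically, between horizontal and vertical ones. The vertices are listed in cyclic
order, from an arbitrary starting point. -/
structure Loop {M N : ℕ} (x : BinaryString N) (y : BinaryString M) where
  /-- the number of edges -/
  length : ℕ
  length_pos : 0 < length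
  /-- the `t`-th vertex; the `t`-th edge goes from `vert t` to `vert (t + 1)` -/
  vert : ZMod length → Vertex M N
  adj : ∀ t, (pattern x y).Adj (vert t) (vert (t + 1))
  edges_distinct : Function.Injective fun t => (vert t, vert (t + 1))
  alternates : ∀ t,
    (IsHorizontal (vert t) (vert (t + 1)) ∧ IsVertical (vert (t + 1)) (vert (t + 1 + 1))) ∨
    (IsVertical (vert t) (vert (t + 1)) ∧ IsHorizontal (vert (t + 1)) (vert (t + 1 + 1)))

namespace Loop

variable {M N : ℕ} {x : BinaryString N} {y : BinaryString M}

/-- The `x`-shift: the number of edges to the right minus the number of edges to the left. -/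
noncomputable def xShift (γ : Loop x y) : ℤ :=
  ({t | IsRight (γ.vert t) (γ.vert (t + 1))}.ncard : ℤ) -
    ({t | IsLeft (γ.vert t) (γ.vert (t + 1))}.ncard : ℤ)

/-- The `y`-shift: the number of upward edges minus the number of downward edges. -/
noncomputable def yShift (γ : Loop x y) : ℤ :=
  ({t | IsUp (γ.vert t) (γ.vert (t + 1))}.ncard : ℤ) -
    ({t | IsDown (γ.vert t) (γ.vert (t + 1))}.ncard : ℤ)

/-- The homology class `(Δx / M, Δy / N)`. -/
noncomputable def homologyClass (γ : Loop x y) : ℚ × ℚ :=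
  ((γ.xShift : ℚ) / (M : ℚ), (γ.yShift : ℚ) / (N : ℚ))

/-- A loop is nontrivial if its homology class is not `(0, 0)`. -/
def Nontrivial (γ : Loop x y) : Prop := γ.homologyClass ≠ (0, 0)

end Loop

/-- The set of the homology classes of the nontrivial loops of `C_{M,N}(x, y)`. -/
def nontrivialClasses {M N : ℕ} (x : BinaryString N) (y : BinaryString M) : Set (ℚ × ℚ) :=
  {c | ∃ γ : Loop x y, γ.Nontrivial ∧ γ.homologyClass = c}

end Hitomezashi

open Hitomezashi

/-! Lift a loop to the plane, with edges of length 2, and follow the midpoints `(u, w)` of its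
edges. Each step is diagonal and changes `height x w` and `height y u` by the same product of signs,
so the lift runs along a level curve of `height x w - height y u` (`Trajectory.height_eq`).
Periodicity then gives `k y * a = k x * b` for the class `(a, b)`. As no edge is repeated, two
points of the curve that agree on the torus differ by a multiple of the class (field `recur`); it
remains to find such pairs of points.

If both drifts are positive, let `p` and `q` be last passages of the two walks at levels compatible
with the curve. On the boundary of the quadrant above and to the right of `(p, q)`, the curve can
only visit the corner, and it never leaves the quadrant. Hence a nontrivial curve passes through the
corner and through its translate by the primitive vector parallel to the drift, which must be the
class (`Trajectory.mul_gcd_eq`). Conversely a curve through a corner cannot close up, whence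
existence. Reflections give the other signs.

If `k y = 0`, a curve with `a > 0` crosses a column of maximal `height y` to the right at its own
highest ordinate (`Trajectory.w_le_of_max`). Two such crossings one turn of the torus apart have
equal ordinates, so the class is `(1, 0)`. If `k x = 0` too, a curve with `a ≠ 0` forces `height x`
to oscillate strictly more than `height y` (`Trajectory.oscillation_lt`), so horizontal and vertical
classes do not coexist. In a symmetric pattern the reflection of a loop in the diagonal is again a
loop, so zero drift excludes nontrivial loops. -/

namespace Hitomezashi

/-! ### Height functions of binary strings -/

/-- The partial sums of `d`, normalized to vanish at `0`. -/
noncomputable def cumul (d : ℤ → ℤ) (n : ℤ) : ℤ :=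
  ∑ i ∈ Finset.Ico 0 n, d i - ∑ i ∈ Finset.Ico n 0, d i

theorem cumul_zero (d : ℤ → ℤ) : cumul d 0 = 0 := by simp [cumul]

theorem cumul_add_one (d : ℤ → ℤ) (n : ℤ) : cumul d (n + 1) = cumul d n + d n := by
  unfold cumul
  rcases le_or_gt 0 n with h | h
  · rw [Finset.Ico_eq_empty (a := n + 1) (by omega), Finset.Ico_eq_empty (a := n) (by omega),
      ← Finset.insert_Ico_right_eq_Ico_add_one h, Finset.sum_insert (by simp)]
    simp [add_comm]
  · rw [Finset.Ico_eq_empty (b := n + 1) (by omega), Finset.Ico_eq_empty (b := n) (by omega),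
      ← Finset.insert_Ico_add_one_left_eq_Ico h, Finset.sum_insert (by simp)]
    simp

theorem cumul_natCast (d : ℤ → ℤ) (n : ℕ) : cumul d n = ∑ i ∈ Finset.range n, d i := by
  induction n with
  | zero => simp [cumul_zero]
  | succ n ih => rw [Nat.cast_succ, cumul_add_one, ih, Finset.sum_range_succ]

theorem cumul_add_period {n : ℕ} [NeZero n] (e : ZMod n → ℤ) (s : ℤ) :
    cumul (fun i => e i) (s + n) = cumul (fun i => e i) s + ∑ t, e t := by
  induction s using Int.induction_on with
  | zero =>
    rw [zero_add, cumul_zero, zero_add, cumul_natCast]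
    refine Finset.sum_bij (fun i _ => (i : ZMod n)) (fun _ _ => Finset.mem_univ _) ?_ ?_ ?_
    · intro a ha b hb h
      rw [ZMod.natCast_eq_natCast_iff'] at h
      rwa [Nat.mod_eq_of_lt (Finset.mem_range.1 ha), Nat.mod_eq_of_lt (Finset.mem_range.1 hb)] at h
    · exact fun b _ => ⟨b.val, Finset.mem_range.2 b.val_lt, by simp⟩
    · simp
  | succ i ih =>
    have h := cumul_add_one (fun i => e i) (i + n)
    rw [add_right_comm, h, ih, cumul_add_one]
    push_cast [ZMod.natCast_self]
    ring_nf
  | pred i ih =>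
    have h := cumul_add_one (fun i => e i) (-i - 1 + n)
    have h' := cumul_add_one (fun i => e i) (-i - 1)
    rw [show (-i - 1 + n + 1 : ℤ) = -i + n by ring, ih] at h
    rw [sub_add_cancel] at h'
    push_cast [ZMod.natCast_self] at h h'
    rw [add_zero] at h
    linarith

theorem k_eq_sum {n : ℕ} [NeZero n] (x : BinaryString n) : k x = ∑ j, (x j : ℤ) := by
  classical
  unfold k
  rw [Set.ncard_eq_toFinset_card', Set.ncard_eq_toFinset_card', Set.toFinset_ofPred,
    Set.toFinset_ofPred, Finset.card_filter, Finset.card_filter]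
  push_cast
  rw [← Finset.sum_sub_distrib]
  refine Finset.sum_congr rfl fun j _ => ?_
  rcases Int.units_eq_one_or (x j) with h | h <;> simp [h]

theorem val_eq_one_or {n : ℕ} (x : BinaryString n) (j : ZMod n) :
    (x j : ℤ) = 1 ∨ (x j : ℤ) = -1 := by
  rcases Int.units_eq_one_or (x j) with h | h <;> simp [h]

/-- The walk with steps `x`, each step being divided into two steps of the same sign: the
`j`-th step of the walk is the pair of steps from `2 * j - 1` to `2 * j + 1`. -/
noncomputable def height {n : ℕ} (x : BinaryString n) (p : ℤ) : ℤ :=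
  cumul (fun i => (x i : ℤ)) ((p + 1) / 2) + cumul (fun i => (x i : ℤ)) ((p + 2) / 2)

section height

variable {n : ℕ} (x : BinaryString n)

theorem height_add_one (p : ℤ) :
    height x (p + 1) = height x p + x (((p + 1) / 2 : ℤ) : ZMod n) := by
  have h := cumul_add_one (fun i => (x i : ℤ)) ((p + 1) / 2)
  unfold height
  rw [show (p + 1 + 2) / 2 = (p + 1) / 2 + 1 by omega, show p + 1 + 1 = p + 2 by ring, h]
  ring

theorem height_two_mul_add_one (j : ℤ) : height x (2 * j + 1) = height x (2 * j) + x j := by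
  rw [height_add_one, show (2 * j + 1) / 2 = j by omega]

theorem height_two_mul_sub_one (j : ℤ) : height x (2 * j - 1) = height x (2 * j) - x j := by
  have h := height_add_one x (2 * j - 1)
  rw [show 2 * j - 1 + 1 = 2 * j by ring, show (2 * j) / 2 = j by omega] at h
  rw [h]; ring

theorem height_add_one_eq_or (p : ℤ) :
    height x (p + 1) = height x p + 1 ∨ height x (p + 1) = height x p - 1 := by
  rw [height_add_one]
  rcases val_eq_one_or x (((p + 1) / 2 : ℤ) : ZMod n) with h | h <;> rw [h]
  · exact .inl rfl
  · exact .inr rfl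

/-- Even points are lattice lines, and both half-steps around `2 * j` have the sign `x j`: the walk
can turn only at odd points. -/
theorem height_sub_eq_of_even {p : ℤ} (hp : p % 2 = 0) :
    height x (p + 1) - height x p = height x p - height x (p - 1) := by
  obtain ⟨j, rfl⟩ := Int.dvd_of_emod_eq_zero hp
  rw [height_two_mul_add_one, height_two_mul_sub_one]
  ring

theorem height_add_emod_two (p : ℤ) : (height x p + p) % 2 = 1 := by
  rcases Int.emod_two_eq_zero_or_one p with hp | hp
  · have h := height_add_one x p
    have h' := val_eq_one_or x (((p + 1) / 2 : ℤ) : ZMod n)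
    have e : height x (p + 1) = 2 * cumul (fun i => (x i : ℤ)) ((p + 2) / 2) := by
      unfold height
      rw [show (p + 1 + 1) / 2 = (p + 2) / 2 by omega, show (p + 1 + 2) / 2 = (p + 2) / 2 by omega]
      ring
    omega
  · have e : height x p = 2 * cumul (fun i => (x i : ℤ)) ((p + 1) / 2) := by
      unfold height
      rw [show (p + 2) / 2 = (p + 1) / 2 by omega]
      ring
    omega

theorem height_add_period [NeZero n] (p : ℤ) : height x (p + 2 * n) = height x p + 2 * k x := by
  have h := cumul_add_period (fun j => (x j : ℤ))
  unfold height
  rw [show (p + 2 * n + 1) / 2 = (p + 1) / 2 + n by omega,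
    show (p + 2 * n + 2) / 2 = (p + 2) / 2 + n by omega, h, h, k_eq_sum]
  ring

end height

/-! ### Last passages and extrema of periodic walks -/

theorem add_mul_period {u : ℤ → ℤ} {P A : ℤ} (h : ∀ s, u (s + P) = u s + A) (s c : ℤ) :
    u (s + c * P) = u s + c * A := by
  induction c using Int.induction_on with
  | zero => simp
  | succ i ih => rw [add_mul, one_mul, ← add_assoc, h, ih]; ring
  | pred i ih =>
    have := h (s + (-i - 1) * P)
    rw [show s + (-(i : ℤ) - 1) * P + P = s + -i * P by ring, ih] at this
    linarith

theorem height_add_mul_period {n : ℕ} [NeZero n] (x : BinaryString n) (p c : ℤ) :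
    height x (p + 2 * (n * c)) = height x p + 2 * (k x * c) := by
  have := add_mul_period (height_add_period x) p c
  rw [show p + 2 * (n * c) = p + c * (2 * n) by ring, this]
  ring

/-- A walk with positive drift leaves each level for the last time. -/
theorem exists_last_passage {u : ℤ → ℤ} {P A : ℤ} (hstep : ∀ s, u (s + 1) ≤ u s + 1)
    (hP : 0 < P) (hA : 0 < A) (hper : ∀ s, u (s + P) = u s + A) (c : ℤ) :
    ∃ s, u s = c ∧ ∀ s', s < s' → c < u s' := by
  have hper' := add_mul_period hper
  obtain ⟨m, -, hm⟩ := Finset.exists_min_image (Finset.Ico 0 P) u ⟨0, by simp [hP]⟩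
  -- In the block of index `s / P` the walk is at least `u m + (s / P) * A`, so level `c` is
  -- exceeded in all late blocks.
  have hbd : ∀ s, u s ≤ c → s ≤ (|c - u m| + 1) * P := by
    intro s hs
    by_contra! hlt
    have h1 := Int.emod_add_mul_ediv s P
    have h2 := Int.emod_nonneg s hP.ne'
    have h3 := Int.emod_lt_of_pos s hP
    have h4 := hm (s % P) (by simp [h2, h3])
    have h5 := hper' (s % P) (s / P)
    rw [show s % P + s / P * P = s by linarith] at h5
    have h6 : |c - u m| < s / P := by
      by_contra! h
      nlinarith
    have h7 := le_abs_self (c - u m)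
    have h8 := abs_nonneg (c - u m)
    nlinarith
  have hne : ∃ s, u s ≤ c := by
    refine ⟨0 + -|u 0 - c| * P, ?_⟩
    rw [hper']
    have h7 := le_abs_self (u 0 - c)
    have h8 := abs_nonneg (u 0 - c)
    nlinarith
  obtain ⟨s, hs, hmax⟩ := Int.exists_greatest_of_bdd ⟨_, hbd⟩ hne
  have hgt : ∀ s', s < s' → c < u s' := by
    intro s' h
    by_contra! h'
    exact absurd (hmax s' h') (by omega)
  exact ⟨s, by have := hgt (s + 1) (by omega); have := hstep s; omega, hgt⟩

theorem exists_height_eq_last {n : ℕ} [NeZero n] {x : BinaryString n} (hk : 0 < k x) (m : ℤ) :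
    ∃ p, height x p = m ∧ ∀ p', p < p' → m < height x p' := by
  have := NeZero.pos n
  refine exists_last_passage (fun s => ?_) (P := 2 * n) (by omega) (by omega)
    (height_add_period x) m
  rcases height_add_one_eq_or x s with h | h <;> omega

theorem height_emod {n : ℕ} [NeZero n] {x : BinaryString n} (hk : k x = 0) (p : ℤ) :
    height x (p % (2 * n)) = height x p := by
  have h := height_add_mul_period x (p % (2 * n)) (p / (2 * n))
  rw [hk, ← mul_assoc, Int.emod_add_mul_ediv] at h
  simpa using h.symm

theorem exists_height_max {n : ℕ} [NeZero n] {x : BinaryString n} (hk : k x = 0) :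
    ∃ p, ∀ p', height x p' ≤ height x p := by
  have hn : (0 : ℤ) < 2 * n := by have := NeZero.pos n; omega
  obtain ⟨p, -, hp⟩ := Finset.exists_max_image (Finset.Ico 0 (2 * n : ℤ)) (height x)
    ⟨0, by simpa using hn⟩
  refine ⟨p, fun p' => ?_⟩
  rw [← height_emod hk]
  exact hp _ (by simp [Int.emod_nonneg p' hn.ne', Int.emod_lt_of_pos p' hn])

/-- The walk goes straight through even points, so a maximum sits at an odd point, where the height
is even. -/
theorem height_emod_two_of_max {n : ℕ} {x : BinaryString n} {p : ℤ}
    (hmax : ∀ p', height x p' ≤ height x p) : height x p % 2 = 0 := by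
  have h := height_add_emod_two x p
  by_contra hp
  have h1 := height_sub_eq_of_even x (p := p) (by omega)
  have h2 := hmax (p + 1)
  have h3 := hmax (p - 1)
  rcases height_add_one_eq_or x p with h | h <;> omega

theorem exists_height_min {n : ℕ} [NeZero n] {x : BinaryString n} (hk : k x = 0) :
    ∃ p, ∀ p', height x p ≤ height x p' := by
  have hn : (0 : ℤ) < 2 * n := by have := NeZero.pos n; omega
  obtain ⟨p, -, hp⟩ := Finset.exists_min_image (Finset.Ico 0 (2 * n : ℤ)) (height x)
    ⟨0, by simpa using hn⟩
  refine ⟨p, fun p' => ?_⟩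
  rw [← height_emod hk p']
  exact hp _ (by simp [Int.emod_nonneg p' hn.ne', Int.emod_lt_of_pos p' hn])

/-! ### Lifted loops as level curves -/

/-- A lift to the plane of a loop of homology class `(a, b)`, recorded by the midpoints
`(u s, w s)` of its edges, in coordinates where the edges have length `2`. It is a level curve
of `height x w - height y u`. -/
structure Trajectory {M N : ℕ} (x : BinaryString N) (y : BinaryString M) where
  u : ℤ → ℤ
  w : ℤ → ℤ
  period : ℤ
  a : ℤ
  b : ℤ
  period_pos : 0 < period
  u_add_period : ∀ s, u (s + period) = u s + 2 * (M * a)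
  w_add_period : ∀ s, w (s + period) = w s + 2 * (N * b)
  u_step : ∀ s, u (s + 1) = u s + 1 ∨ u (s + 1) = u s - 1
  w_step : ∀ s, w (s + 1) = w s + 1 ∨ w (s + 1) = w s - 1
  height_x : ∀ s, height x (w (s + 1)) - height x (w s) = (u (s + 1) - u s) * (w (s + 1) - w s)
  height_y : ∀ s, height y (u (s + 1)) - height y (u s) = (u (s + 1) - u s) * (w (s + 1) - w s)
  odd : ∀ s, (u s + w s) % 2 = 1
  recur : ∀ s s' α β, u s' = u s + 2 * (M * α) → w s' = w s + 2 * (N * β) →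
    ∃ r, α = r * a ∧ β = r * b

namespace Trajectory

variable {M N : ℕ} {x : BinaryString N} {y : BinaryString M} (T : Trajectory x y)

/-- The constant value of `height x w - height y u` along the trajectory. -/
noncomputable def level : ℤ := height x (T.w 0) - height y (T.u 0)

theorem height_eq (s : ℤ) : height x (T.w s) = height y (T.u s) + T.level := by
  induction s using Int.induction_on with
  | zero => simp [level]
  | succ i ih => linarith [T.height_x i, T.height_y i]
  | pred i ih =>
    have h1 := T.height_x (-i - 1)
    have h2 := T.height_y (-i - 1)
    rw [sub_add_cancel] at h1 h2
    linarith

/-- An edge midpoint has one even and one odd coordinate, so the two heights have opposite parities.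
This makes the comparison of oscillations strict. -/
theorem level_emod_two : T.level % 2 = 1 := by
  have h1 := height_add_emod_two x (T.w 0)
  have h2 := height_add_emod_two y (T.u 0)
  have h3 := T.odd 0
  unfold level
  omega

theorem k_mul_eq [NeZero M] [NeZero N] : k y * T.a = k x * T.b := by
  have h1 := T.height_eq (0 + T.period)
  rw [T.u_add_period, T.w_add_period, height_add_mul_period, height_add_mul_period,
    T.height_eq 0] at h1
  linarith

theorem exists_u_eq_of_pos [NeZero M] (ha : 0 < T.a) (c : ℤ) :
    ∃ s, T.u s = c ∧ ∀ s', s < s' → c < T.u s' := by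
  have hM : (0 : ℤ) < M := by exact_mod_cast NeZero.pos M
  refine exists_last_passage (fun s => ?_) T.period_pos (A := 2 * (M * T.a)) (by positivity)
    T.u_add_period c
  rcases T.u_step s with h | h <;> omega

/-- Time reversal makes the drift positive. -/
theorem exists_u_eq_of_neg [NeZero M] (ha : T.a < 0) (c : ℤ) :
    ∃ s, T.u s = c ∧ ∀ s', s' < s → c < T.u s' := by
  have hM : (0 : ℤ) < M := by exact_mod_cast NeZero.pos M
  have hstep : ∀ s, T.u (-(s + 1)) ≤ T.u (-s) + 1 := by
    intro s
    have := T.u_step (-s - 1)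
    rw [sub_add_cancel] at this
    rw [neg_add, ← sub_eq_add_neg]
    omega
  have hper : ∀ s, T.u (-(s + T.period)) = T.u (-s) + -(2 * (M * T.a)) := by
    intro s
    have := T.u_add_period (-(s + T.period))
    rw [neg_add, neg_add_cancel_right] at this
    rw [neg_add]
    linarith
  obtain ⟨s, hs, hs'⟩ := exists_last_passage (u := fun s => T.u (-s)) hstep T.period_pos
    (by nlinarith) hper c
  exact ⟨-s, hs, fun s' h => by simpa using hs' (-s') (by omega)⟩

theorem exists_u_eq [NeZero M] (ha : T.a ≠ 0) (c : ℤ) : ∃ s, T.u s = c := by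
  rcases lt_or_gt_of_ne ha with h | h
  · exact (T.exists_u_eq_of_neg h c).imp fun _ h => h.1
  · exact (T.exists_u_eq_of_pos h c).imp fun _ h => h.1

/-! ### Zero drift: extremal columns -/

/-- A trajectory that winds horizontally around the torus meets the columns on which `height y` is
extremal, so that `height x` has a larger oscillation than `height y`. -/
theorem oscillation_lt [NeZero M] (ha : T.a ≠ 0) {p p' q q' : ℤ}
    (hp : ∀ r, height y r ≤ height y p) (hq : ∀ r, height x r ≤ height x q)
    (hq' : ∀ r, height x q' ≤ height x r) :
    height y p - height y p' < height x q - height x q' := by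
  -- Both maxima are even and the level is odd, so the inequality between the maxima, shifted by the
  -- level, is strict.
  have h1 := height_emod_two_of_max hp
  have h2 := height_emod_two_of_max hq
  obtain ⟨s, rfl⟩ := T.exists_u_eq ha p
  obtain ⟨s', rfl⟩ := T.exists_u_eq ha p'
  have h3 := T.height_eq s
  have h4 := T.height_eq s'
  have h5 := hq (T.w s)
  have h6 := hq' (T.w s')
  have h7 := T.level_emod_two
  omega

/-- A trajectory that crosses to the right a column on which `height y` is maximal does so at its
maximal ordinate. -/
theorem w_le_of_max {s : ℤ} (hmax : ∀ p, height y p ≤ height y (T.u s))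
    (hs : T.u (s + 1) = T.u s + 1) (s' : ℤ) : T.w s' ≤ T.w s := by
  have hodd := T.odd s
  have hpar := height_add_emod_two y (T.u s)
  have hmax2 := height_emod_two_of_max hmax
  have hw := height_sub_eq_of_even x (p := T.w s) (by omega)
  have hx := T.height_x s
  -- The step goes right, so `height x` changes by the same amount as the ordinate; if it goes down,
  -- use that the walk is straight at `T.w s`, which is even because `T.u s` is odd.
  have htop : height x (T.w s + 1) = height x (T.w s) + 1 := by
    rcases T.w_step s with h | h
    · rw [h, hs] at hx; linarith
    · rw [h, hs] at hx; linarith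
  -- On that ordinate the level equation would require `height y` to exceed its maximum; the curve
  -- is thus confined below it.
  have hne : ∀ t, T.w t ≠ T.w s + 1 := by
    intro t ht
    have h1 := T.height_eq t
    rw [ht, htop, T.height_eq s] at h1
    linarith [hmax (T.u t)]
  have hstep : ∀ t, T.w t ≤ T.w s ↔ T.w (t + 1) ≤ T.w s := by
    intro t
    have h1 := hne t
    have h2 := hne (t + 1)
    rcases T.w_step t with h | h <;> omega
  have key : ∀ d : ℤ, T.w (s + d) ≤ T.w s := by
    intro d
    induction d using Int.induction_on with
    | zero => simp
    | succ i ih => rw [← add_assoc]; exact (hstep _).1 ih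
    | pred i ih =>
      refine (hstep _).2 ?_
      rwa [show s + (-(i : ℤ) - 1) + 1 = s + -i by ring]
  simpa using key (s' - s)

theorem eq_one_and_eq_zero [NeZero M] [NeZero N] (hk : k y = 0) (ha : 0 < T.a) :
    T.a = 1 ∧ T.b = 0 := by
  obtain ⟨p, hp⟩ := exists_height_max hk
  have hcross : ∀ c, ∃ s, T.u s = c ∧ T.u (s + 1) = T.u s + 1 := by
    intro c
    obtain ⟨s, h1, h2⟩ := T.exists_u_eq_of_pos ha c
    have := h2 (s + 1) (by omega)
    refine ⟨s, h1, ?_⟩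
    rcases T.u_step s with h | h <;> omega
  obtain ⟨s, h1, h2⟩ := hcross p
  obtain ⟨s', h1', h2'⟩ := hcross (p + 2 * (M * 1))
  have hper := height_add_mul_period y p 1
  rw [hk, zero_mul, mul_zero, add_zero] at hper
  -- Both crossings take place at the highest ordinate of the trajectory.
  have hw : T.w s' = T.w s + 2 * (N * 0) := by
    have h3 := T.w_le_of_max (s := s) (by rwa [h1]) h2 s'
    have h4 := T.w_le_of_max (s := s') (by rwa [h1', hper]) h2' s
    omega
  obtain ⟨r, hr, hr'⟩ := T.recur s s' 1 0 (by rw [h1, h1']) hw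
  have hr0 : r ≠ 0 := by rintro rfl; simp at hr
  refine ⟨?_, by simpa [hr0] using hr'.symm⟩
  exact Int.eq_one_of_dvd_one ha.le ⟨r, by linarith⟩

/-! ### Positive drift: corners and trapping quadrants -/

/-- A point of the level curve at which both walks leave their level for the last time. -/
structure IsCorner (x : BinaryString N) (y : BinaryString M) (p q : ℤ) : Prop where
  u_last : ∀ p', p < p' → height y p < height y p'
  w_last : ∀ q', q < q' → height x q < height x q'

section corner

variable {T} {p q : ℤ}

/-- Along either side of the quadrant one height is fixed, while the other, away from the corner,
exceeds its value there. -/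
theorem eq_corner_of_boundary (hC : IsCorner x y p q) (hl : height x q = height y p + T.level)
    {s : ℤ} (hu : p ≤ T.u s) (hw : q ≤ T.w s)
    (h : T.u s = p ∨ T.w s = q) : T.u s = p ∧ T.w s = q := by
  have hs := T.height_eq s
  rcases h with h | h
  · refine ⟨h, ?_⟩
    by_contra hne
    have := hC.w_last (T.w s) (by omega)
    rw [h] at hs
    omega
  · refine ⟨?_, h⟩
    by_contra hne
    have := hC.u_last (T.u s) (by omega)
    rw [h] at hs
    omega

/-- The only possible exit is the corner. There a step with opposite signs would make a height drop
just after its last passage; a step with both signs negative is excluded at the even coordinate,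
through which the walk goes straight. -/
theorem quadrant_step (hC : IsCorner x y p q) (hl : height x q = height y p + T.level)
    {s : ℤ} (hu : p ≤ T.u s) (hw : q ≤ T.w s) :
    p ≤ T.u (s + 1) ∧ q ≤ T.w (s + 1) := by
  by_contra hout
  have hus := T.u_step s
  have hws := T.w_step s
  obtain ⟨h1, h2⟩ := eq_corner_of_boundary hC hl hu hw (by omega)
  have hx := T.height_x s
  have hy := T.height_y s
  have hp := hC.u_last (p + 1) (by omega)
  have hq := hC.w_last (q + 1) (by omega)
  have hodd := T.odd s
  have hpar : p % 2 = 0 ∨ q % 2 = 0 := by omega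
  rcases hus with h3 | h3 <;> rcases hws with h4 | h4 <;> rw [h3, h4, h1, h2] at hx hy
  · omega
  · linarith
  · linarith
  · rcases hpar with h | h
    · have := height_sub_eq_of_even y h
      linarith
    · have := height_sub_eq_of_even x h
      linarith

theorem quadrant_of_le (hC : IsCorner x y p q) (hl : height x q = height y p + T.level)
    {s s' : ℤ} (hss' : s ≤ s') (hu : p ≤ T.u s) (hw : q ≤ T.w s) :
    p ≤ T.u s' ∧ q ≤ T.w s' := by
  induction s', hss' using Int.leInduction with
  | base => exact ⟨hu, hw⟩
  | succ t _ ih => exact quadrant_step hC hl ih.1 ih.2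

/-- The predecessor would be `(p + 1, q + 1)`, and the signs of the step would put `height x (q +
1)` below `height x q`. -/
theorem not_quadrant_pred_corner (hC : IsCorner x y p q) {s : ℤ}
    (hu : T.u (s + 1) = p) (hw : T.w (s + 1) = q) :
    ¬ (p ≤ T.u s ∧ q ≤ T.w s) := by
  intro h
  have h1 : T.u s = p + 1 := by rcases T.u_step s with h | h <;> omega
  have h2 : T.w s = q + 1 := by rcases T.w_step s with h | h <;> omega
  have hx := T.height_x s
  rw [hu, hw, h1, h2] at hx
  have := hC.w_last (q + 1) (by omega)
  linarith

theorem exists_eq_corner (hC : IsCorner x y p q) (hl : height x q = height y p + T.level)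
    {s s' : ℤ} (hss' : s ≤ s') (hs : ¬ (p ≤ T.u s ∧ q ≤ T.w s))
    (hs' : p ≤ T.u s' ∧ q ≤ T.w s') : ∃ t, T.u t = p ∧ T.w t = q := by
  by_contra! hne
  suffices ¬ (p ≤ T.u s' ∧ q ≤ T.w s') from this hs'
  clear hs'
  induction s', hss' using Int.leInduction with
  | base => exact hs
  | succ t _ ih =>
    rintro ⟨h1, h2⟩
    have hus := T.u_step t
    have hws := T.w_step t
    obtain ⟨h3, h4⟩ := eq_corner_of_boundary hC hl h1 h2 (by omega)
    exact hne _ h3 h4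

end corner

theorem IsCorner.translate [NeZero M] [NeZero N] {p q α β : ℤ} (hC : IsCorner x y p q) :
    IsCorner x y (p + 2 * (M * α)) (q + 2 * (N * β)) := by
  constructor
  · intro p' hp'
    have := hC.u_last (p' + 2 * (M * -α)) (by linarith)
    rw [height_add_mul_period] at this ⊢
    linarith
  · intro p' hp'
    have := hC.w_last (p' + 2 * (N * -β)) (by linarith)
    rw [height_add_mul_period] at this ⊢
    linarith

theorem exists_far {A B : ℤ} (hA : 0 < A) (hB : 0 < B) (p q u w : ℤ) :
    ∃ c, 0 < c ∧ p ≤ u + c * A ∧ q ≤ w + c * B ∧ u + -c * A < p := by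
  have h1 := abs_nonneg (p - u)
  have h2 := abs_nonneg (q - w)
  have h3 := le_abs_self (p - u)
  have h4 := le_abs_self (q - w)
  have h5 := neg_abs_le (p - u)
  refine ⟨|p - u| + |q - w| + 1, by omega, ?_, ?_, ?_⟩ <;> nlinarith

/-- With negative class the curve would lie in the quadrant in the far past and outside it in the
far future, though the quadrant cannot be left. -/
theorem a_pos [NeZero M] [NeZero N] (hx : 0 < k x) (hy : 0 < k y)
    (h : T.a ≠ 0 ∨ T.b ≠ 0) : 0 < T.a := by
  have hM : (0 : ℤ) < M := by exact_mod_cast NeZero.pos M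
  have hN : (0 : ℤ) < N := by exact_mod_cast NeZero.pos N
  have hk := T.k_mul_eq
  have ha0 : T.a ≠ 0 := by
    rintro h0
    rw [h0, mul_zero, eq_comm, mul_eq_zero] at hk
    omega
  by_contra hneg
  have ha : T.a < 0 := by omega
  have hb : T.b < 0 := by nlinarith
  obtain ⟨q, hq, hq'⟩ := exists_height_eq_last hx T.level
  obtain ⟨p, hp, hp'⟩ := exists_height_eq_last hy 0
  have hC : IsCorner x y p q := ⟨by rwa [hp], by rwa [hq]⟩
  have hl : height x q = height y p + T.level := by omega
  obtain ⟨c, hc, h1, h2, h3⟩ := exists_far (A := -(2 * (M * T.a))) (B := -(2 * (N * T.b)))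
    (by nlinarith) (by nlinarith) p q (T.u 0) (T.w 0)
  have hu := add_mul_period T.u_add_period 0
  have hw := add_mul_period T.w_add_period 0
  have := T.period_pos
  have h4 := quadrant_of_le hC hl (s := 0 + -c * T.period) (s' := 0 + c * T.period) (by nlinarith)
    (by rw [hu]; linarith) (by rw [hw]; linarith)
  rw [hu] at h4
  linarith [h4.1]

theorem exists_eq_corner_of_pos [NeZero M] [NeZero N] (ha : 0 < T.a) (hb : 0 < T.b) {p q : ℤ}
    (hC : IsCorner x y p q) (hl : height x q = height y p + T.level) :
    ∃ t, T.u t = p ∧ T.w t = q := by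
  have hM : (0 : ℤ) < M := by exact_mod_cast NeZero.pos M
  have hN : (0 : ℤ) < N := by exact_mod_cast NeZero.pos N
  obtain ⟨c, hc, h1, h2, h3⟩ := exists_far (A := 2 * (M * T.a)) (B := 2 * (N * T.b))
    (by positivity) (by positivity) p q (T.u 0) (T.w 0)
  have hu := add_mul_period T.u_add_period 0
  have hw := add_mul_period T.w_add_period 0
  have := T.period_pos
  refine exists_eq_corner hC hl (s := 0 + -c * T.period) (s' := 0 + c * T.period) (by nlinarith)
    ?_ ?_
  · rw [hu]; intro h; linarith [h.1]
  · rw [hu, hw]; exact ⟨h1, h2⟩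

/-- If both walks have positive drift, the class of a nontrivial loop is the primitive class
parallel to the drift. -/
theorem mul_gcd_eq [NeZero M] [NeZero N] (hx : 0 < k x) (hy : 0 < k y)
    (h : T.a ≠ 0 ∨ T.b ≠ 0) :
    T.a * (k x).gcd (k y) = k x ∧ T.b * (k x).gcd (k y) = k y := by
  have ha := T.a_pos hx hy h
  have hb : 0 < T.b := by nlinarith [T.k_mul_eq]
  obtain ⟨q, hq, hq'⟩ := exists_height_eq_last hx T.level
  obtain ⟨p, hp, hp'⟩ := exists_height_eq_last hy 0
  have hC : IsCorner x y p q := ⟨by rwa [hp], by rwa [hq]⟩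
  have hl : height x q = height y p + T.level := by omega
  obtain ⟨g, α, β, hg, hcop, hα, hβ⟩ := Int.exists_gcd_one' (m := k x) (n := k y)
    (Int.gcd_pos_of_ne_zero_left _ hx.ne')
  have hgcd : (k x).gcd (k y) = g := by
    rw [hα, hβ, Int.gcd_mul_right, hcop]; simp
  obtain ⟨s, hs, hs'⟩ := T.exists_eq_corner_of_pos ha hb hC hl
  -- Translation along the drift preserves the level, since `k x * β = k y * α`.
  obtain ⟨t, ht, ht'⟩ := T.exists_eq_corner_of_pos ha hb (hC.translate (α := α) (β := β)) (by
    rw [height_add_mul_period, height_add_mul_period, hl, hα, hβ]; ring)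
  obtain ⟨r, hr, hr'⟩ := T.recur s t α β (by rw [ht, hs]) (by rw [ht', hs'])
  have hα0 : 0 < α := by
    have : (0 : ℤ) < g := by exact_mod_cast hg
    by_contra! hle
    nlinarith
  have hr0 : 0 < r := by
    by_contra! hle
    nlinarith
  have hr1 : r = 1 := Int.eq_one_of_dvd_one hr0.le (by
    have := Int.dvd_coe_gcd (a := α) (b := β) (c := r) ⟨_, hr⟩ ⟨_, hr'⟩
    rwa [hcop] at this)
  rw [hr1, one_mul] at hr hr'
  rw [hgcd, ← hr, ← hr', ← hα, ← hβ]
  exact ⟨rfl, rfl⟩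

/-- A trajectory through a corner does not close up in the plane. -/
theorem ne_zero_of_eq_corner {p q s : ℤ} (hC : IsCorner x y p q) (hu : T.u s = p)
    (hw : T.w s = q) : T.a ≠ 0 ∨ T.b ≠ 0 := by
  by_contra! h0
  have hl := T.height_eq s
  rw [hu, hw] at hl
  have hu' := T.u_add_period s
  have hw' := T.w_add_period s
  rw [h0.1, hu, mul_zero, mul_zero, add_zero] at hu'
  rw [h0.2, hw, mul_zero, mul_zero, add_zero] at hw'
  have := T.period_pos
  refine not_quadrant_pred_corner hC (s := s + T.period - 1) (T := T)
    (by rwa [sub_add_cancel]) (by rwa [sub_add_cancel]) ?_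
  exact quadrant_of_le hC hl (by omega) hu.ge hw.ge

end Trajectory
-- Edges and their displacements
open Classical in
/-- The horizontal displacement along an edge. -/
noncomputable def edgeX {M N : ℕ} (v w : Vertex M N) : ℤ :=
  (if IsRight v w then 1 else 0) - (if IsLeft v w then 1 else 0)

open Classical in
/-- The vertical displacement along an edge. -/
noncomputable def edgeY {M N : ℕ} (v w : Vertex M N) : ℤ :=
  (if IsUp v w then 1 else 0) - (if IsDown v w then 1 else 0)

theorem one_ne_zero_of_three_le {n : ℕ} (hn : 3 ≤ n) : (1 : ZMod n) ≠ 0 := by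
  have : Fact (1 < n) := ⟨by omega⟩
  exact one_ne_zero

theorem one_add_one_ne_zero_of_three_le {n : ℕ} (hn : 3 ≤ n) : (1 + 1 : ZMod n) ≠ 0 := by
  intro h
  have h2 : ((2 : ℕ) : ZMod n) = 0 := by rw [← h]; norm_num
  rw [ZMod.natCast_eq_zero_iff] at h2
  have := Nat.le_of_dvd (by norm_num) h2
  omega

section edges

variable {M N : ℕ} {x : BinaryString N} {y : BinaryString M}

/-- As `1 ≠ -1` modulo `M`, an edge is not both to the right and to the left; as `1 ≠ 0` modulo `N`,
it is not vertical either. -/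
theorem adj_horizontal (hM : 3 ≤ M) (hN : 3 ≤ N) {v w : Vertex M N}
    (hw : w = (v.1 + ((x v.2 : ℤ) : ZMod M), v.2)) :
    (pattern x y).Adj v w ∧ IsHorizontal v w ∧ ¬ IsVertical v w ∧
      edgeX v w = x v.2 ∧ edgeY v w = 0 := by
  have h1 := one_ne_zero_of_three_le hM
  have h2 := one_add_one_ne_zero_of_three_le hM
  have h3 := one_ne_zero_of_three_le hN
  obtain ⟨i, j⟩ := v
  subst hw
  rcases Int.units_eq_one_or (x j) with h | h
  · have hL : ¬ IsLeft (i, j) ((i + 1, j) : Vertex M N) := by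
      simp [IsLeft, add_assoc, h2]
    simp [pattern, IsHorizontal, IsVertical, edgeX, edgeY, hL, IsRight, IsUp, IsDown, h, h3]
  · have hR : ¬ IsRight (i, j) ((i + -1, j) : Vertex M N) := by
      simp only [IsRight, Prod.mk.injEq, and_true, add_right_inj]
      exact fun h' => h2 (eq_neg_iff_add_eq_zero.1 h'.symm)
    simp [pattern, IsHorizontal, IsVertical, edgeX, edgeY, hR, IsLeft, IsUp, IsDown, h, h3]

theorem adj_vertical (hM : 3 ≤ M) (hN : 3 ≤ N) {v w : Vertex M N}
    (hw : w = (v.1, v.2 + ((y v.1 : ℤ) : ZMod N))) :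
    (pattern x y).Adj v w ∧ ¬ IsHorizontal v w ∧ IsVertical v w ∧
      edgeX v w = 0 ∧ edgeY v w = y v.1 := by
  have h1 := one_ne_zero_of_three_le hN
  have h2 := one_add_one_ne_zero_of_three_le hN
  have h3 := one_ne_zero_of_three_le hM
  obtain ⟨i, j⟩ := v
  subst hw
  rcases Int.units_eq_one_or (y i) with h | h
  · have hL : ¬ IsDown (i, j) ((i, j + 1) : Vertex M N) := by
      simp [IsDown, add_assoc, h2]
    simp [pattern, IsHorizontal, IsVertical, edgeX, edgeY, hL, IsRight, IsUp, IsLeft, h, h3]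
  · have hR : ¬ IsUp (i, j) ((i, j + -1) : Vertex M N) := by
      simp only [IsUp, Prod.mk.injEq, true_and, add_right_inj]
      exact fun h' => h2 (eq_neg_iff_add_eq_zero.1 h'.symm)
    simp [pattern, IsHorizontal, IsVertical, edgeX, edgeY, hR, IsLeft, IsRight, IsDown, h, h3]

theorem eq_of_adj {v w : Vertex M N} (h : (pattern x y).Adj v w) :
    w = (v.1 + ((x v.2 : ℤ) : ZMod M), v.2) ∨ w = (v.1, v.2 + ((y v.1 : ℤ) : ZMod N)) := by
  rcases h with ⟨h, hx⟩ | ⟨h, hx⟩ | ⟨h, hx⟩ | ⟨h, hx⟩ <;>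
    simp only [IsRight, IsLeft, IsUp, IsDown] at h
  · left; rw [h, hx]; simp
  · left; rw [hx]; rw [h]; simp
  · right; rw [h, hx]; simp
  · right; rw [hx]; rw [h]; simp

end edges

/-! ### Lifting loops to the plane -/

namespace Loop

variable {M N : ℕ} {x : BinaryString N} {y : BinaryString M} (γ : Loop x y)

instance : NeZero γ.length := ⟨γ.length_pos.ne'⟩

/-- The horizontal displacement along the `t`-th edge. -/
noncomputable def dx (t : ZMod γ.length) : ℤ := edgeX (γ.vert t) (γ.vert (t + 1))

/-- The vertical displacement along the `t`-th edge. -/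
noncomputable def dy (t : ZMod γ.length) : ℤ := edgeY (γ.vert t) (γ.vert (t + 1))

theorem sum_dx : ∑ t, γ.dx t = γ.xShift := by
  classical
  unfold xShift dx edgeX
  rw [Set.ncard_eq_toFinset_card', Set.ncard_eq_toFinset_card', Set.toFinset_ofPred,
    Set.toFinset_ofPred, Finset.card_filter, Finset.card_filter]
  push_cast
  rw [← Finset.sum_sub_distrib]

theorem sum_dy : ∑ t, γ.dy t = γ.yShift := by
  classical
  unfold yShift dy edgeY
  rw [Set.ncard_eq_toFinset_card', Set.ncard_eq_toFinset_card', Set.toFinset_ofPred,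
    Set.toFinset_ofPred, Finset.card_filter, Finset.card_filter]
  push_cast
  rw [← Finset.sum_sub_distrib]

/-- The `t`-th edge is horizontal. -/
structure HStep (t : ZMod γ.length) : Prop where
  dx_eq : γ.dx t = x (γ.vert t).2
  dy_eq : γ.dy t = 0
  vert_eq : γ.vert (t + 1) = ((γ.vert t).1 + ((x (γ.vert t).2 : ℤ) : ZMod M), (γ.vert t).2)

/-- The `t`-th edge is vertical. -/
structure VStep (t : ZMod γ.length) : Prop where
  dx_eq : γ.dx t = 0
  dy_eq : γ.dy t = y (γ.vert t).1
  vert_eq : γ.vert (t + 1) = ((γ.vert t).1, (γ.vert t).2 + ((y (γ.vert t).1 : ℤ) : ZMod N))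

theorem hStep_of_isHorizontal (hM : 3 ≤ M) (hN : 3 ≤ N) {t : ZMod γ.length}
    (h : IsHorizontal (γ.vert t) (γ.vert (t + 1))) : γ.HStep t := by
  rcases eq_of_adj (γ.adj t) with e | e
  · obtain ⟨-, -, -, h1, h2⟩ := adj_horizontal (x := x) (y := y) hM hN e
    exact ⟨h1, h2, e⟩
  · exact absurd h (adj_vertical (x := x) (y := y) hM hN e).2.1

theorem vStep_of_isVertical (hM : 3 ≤ M) (hN : 3 ≤ N) {t : ZMod γ.length}
    (h : IsVertical (γ.vert t) (γ.vert (t + 1))) : γ.VStep t := by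
  rcases eq_of_adj (γ.adj t) with e | e
  · exact absurd h (adj_horizontal (x := x) (y := y) hM hN e).2.2.1
  · obtain ⟨-, -, -, h1, h2⟩ := adj_vertical (x := x) (y := y) hM hN e
    exact ⟨h1, h2, e⟩

theorem step_alternates (hM : 3 ≤ M) (hN : 3 ≤ N) (t : ZMod γ.length) :
    (γ.HStep t ∧ γ.VStep (t + 1)) ∨ (γ.VStep t ∧ γ.HStep (t + 1)) :=
  (γ.alternates t).imp
    (fun h => ⟨γ.hStep_of_isHorizontal hM hN h.1, γ.vStep_of_isVertical hM hN h.2⟩)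
    (fun h => ⟨γ.vStep_of_isVertical hM hN h.1, γ.hStep_of_isHorizontal hM hN h.2⟩)

/-- The abscissa of the lift of the loop to the plane that starts at abscissa `i`. -/
noncomputable def col (i s : ℤ) : ℤ := i + cumul (fun s => γ.dx s) s

/-- The ordinate of the lift of the loop to the plane that starts at ordinate `j`. -/
noncomputable def row (j s : ℤ) : ℤ := j + cumul (fun s => γ.dy s) s

theorem col_add_one (i s : ℤ) : γ.col i (s + 1) = γ.col i s + γ.dx s := by
  simp only [col, cumul_add_one, add_assoc]

theorem row_add_one (j s : ℤ) : γ.row j (s + 1) = γ.row j s + γ.dy s := by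
  simp only [row, cumul_add_one, add_assoc]

theorem col_add_length (i s : ℤ) : γ.col i (s + γ.length) = γ.col i s + γ.xShift := by
  simp only [col, cumul_add_period, sum_dx, add_assoc]

theorem row_add_length (j s : ℤ) : γ.row j (s + γ.length) = γ.row j s + γ.yShift := by
  simp only [row, cumul_add_period, sum_dy, add_assoc]

theorem vert_add_one_eq (hM : 3 ≤ M) (hN : 3 ≤ N) (t : ZMod γ.length) :
    γ.vert (t + 1) = ((γ.vert t).1 + (γ.dx t : ZMod M), (γ.vert t).2 + (γ.dy t : ZMod N)) := by
  rcases γ.step_alternates hM hN t with ⟨h, -⟩ | ⟨h, -⟩ <;>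
    rw [h.vert_eq, h.dx_eq, h.dy_eq] <;> simp

theorem vert_eq_lift (hM : 3 ≤ M) (hN : 3 ≤ N) {i j : ℤ} (hij : γ.vert 0 = (↑i, ↑j)) (s : ℤ) :
    γ.vert s = (↑(γ.col i s), ↑(γ.row j s)) := by
  induction s using Int.induction_on with
  | zero => simp [col, row, cumul_zero, hij]
  | succ n ih =>
    push_cast at ih ⊢
    rw [vert_add_one_eq γ hM hN, ih, col_add_one, row_add_one]
    simp
  | pred n ih =>
    have h := γ.vert_add_one_eq hM hN ((-n - 1 : ℤ) : ZMod γ.length)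
    have h1 := γ.col_add_one i (-n - 1)
    have h2 := γ.row_add_one j (-n - 1)
    rw [sub_add_cancel] at h1 h2
    rw [show (((-n - 1 : ℤ) : ZMod γ.length) + 1) = ((-n : ℤ) : ZMod γ.length) by push_cast; ring,
      ih, h1, h2] at h
    push_cast at h ⊢
    simp only [Prod.mk.injEq, add_left_inj] at h
    exact Prod.ext h.1.symm h.2.symm

theorem exists_xShift_eq (hM : 3 ≤ M) (hN : 3 ≤ N) :
    ∃ a b : ℤ, γ.xShift = M * a ∧ γ.yShift = N * b := by
  obtain ⟨i, hi⟩ := ZMod.intCast_surjective (γ.vert 0).1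
  obtain ⟨j, hj⟩ := ZMod.intCast_surjective (γ.vert 0).2
  have hij : γ.vert 0 = (↑i, ↑j) := by rw [hi, hj]
  have h := γ.vert_eq_lift hM hN hij (0 + γ.length)
  rw [col_add_length, row_add_length] at h
  push_cast at h
  rw [zero_add, ZMod.natCast_self, hij] at h
  simp only [col, row, cumul_zero, add_zero, Prod.mk.injEq, left_eq_add] at h
  obtain ⟨a, ha⟩ := (ZMod.intCast_zmod_eq_zero_iff_dvd _ _).1 h.1
  obtain ⟨b, hb⟩ := (ZMod.intCast_zmod_eq_zero_iff_dvd _ _).1 h.2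
  exact ⟨a, b, ha, hb⟩

end Loop

theorem height_two_mul_add {n : ℕ} (x : BinaryString n) (j : ℤ) {e : ℤ} (he : e = 1 ∨ e = -1) :
    height x (2 * j + e) = height x (2 * j) + e * x j := by
  rcases he with rfl | rfl
  · rw [height_two_mul_add_one, one_mul]
  · rw [← sub_eq_add_neg, height_two_mul_sub_one]; ring

namespace Loop

variable {M N : ℕ} {x : BinaryString N} {y : BinaryString M} (γ : Loop x y)

/-- A midpoint on the torus determines its oriented edge: parity tells whether it is horizontal, and
the string gives its direction. The edges of a loop are distinct. -/
theorem eq_of_midpoint_eq (hM : 3 ≤ M) (hN : 3 ≤ N) {i j : ℤ} (hij : γ.vert 0 = (↑i, ↑j))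
    {s s' α β : ℤ}
    (hu : γ.col i s' + γ.col i (s' + 1) = γ.col i s + γ.col i (s + 1) + 2 * (M * α))
    (hw : γ.row j s' + γ.row j (s' + 1) = γ.row j s + γ.row j (s + 1) + 2 * (N * β)) :
    (s : ZMod γ.length) = s' := by
  have hs := γ.vert_eq_lift hM hN hij s
  have hs' := γ.vert_eq_lift hM hN hij s'
  rw [col_add_one, col_add_one] at hu
  rw [row_add_one, row_add_one] at hw
  apply γ.edges_distinct
  suffices γ.vert s = γ.vert s' ∧ γ.vert (s + 1) = γ.vert (s' + 1) from Prod.ext this.1 this.2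
  rcases γ.step_alternates hM hN s with ⟨h, -⟩ | ⟨h, -⟩ <;>
    rcases γ.step_alternates hM hN s' with ⟨h', -⟩ | ⟨h', -⟩
  · rw [h.dy_eq, h'.dy_eq] at hw
    have hrow : γ.row j s' = γ.row j s + N * β := by omega
    have h2 : (γ.vert s').2 = (γ.vert s).2 := by rw [hs, hs', hrow]; simp
    rw [h.dx_eq, h'.dx_eq, h2] at hu
    have hcol : γ.col i s' = γ.col i s + M * α := by omega
    have heq : γ.vert s = γ.vert s' := by rw [hs, hs', hrow, hcol]; simp
    exact ⟨heq, by rw [h.vert_eq, h'.vert_eq, heq]⟩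
  · rw [h.dx_eq, h'.dx_eq] at hu
    have := val_eq_one_or x (γ.vert s).2
    omega
  · rw [h.dx_eq, h'.dx_eq] at hu
    have := val_eq_one_or x (γ.vert s').2
    omega
  · rw [h.dx_eq, h'.dx_eq] at hu
    have hcol : γ.col i s' = γ.col i s + M * α := by omega
    have h2 : (γ.vert s').1 = (γ.vert s).1 := by rw [hs, hs', hcol]; simp
    rw [h.dy_eq, h'.dy_eq, h2] at hw
    have hrow : γ.row j s' = γ.row j s + N * β := by omega
    have heq : γ.vert s = γ.vert s' := by rw [hs, hs', hrow, hcol]; simp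
    exact ⟨heq, by rw [h.vert_eq, h'.vert_eq, heq]⟩

theorem exists_trajectory (hM : 3 ≤ M) (hN : 3 ≤ N) {i j : ℤ} (hij : γ.vert 0 = (↑i, ↑j)) :
    ∃ T : Trajectory x y, γ.homologyClass = ((T.a : ℚ), (T.b : ℚ)) ∧
      T.u 0 = 2 * i + γ.dx 0 ∧ T.w 0 = 2 * j + γ.dy 0 := by
  obtain ⟨a, b, ha, hb⟩ := γ.exists_xShift_eq hM hN
  have hs := γ.vert_eq_lift hM hN hij
  have hc1 := γ.col_add_one i
  have hr1 := γ.row_add_one j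
  have hcL := γ.col_add_length i
  have hrL := γ.row_add_length j
  have huL : ∀ s, γ.col i (s + γ.length) + γ.col i (s + γ.length + 1) =
      γ.col i s + γ.col i (s + 1) + 2 * (M * a) := by
    intro s
    rw [add_right_comm, hcL, hcL, ha]; ring
  have hwL : ∀ s, γ.row j (s + γ.length) + γ.row j (s + γ.length + 1) =
      γ.row j s + γ.row j (s + 1) + 2 * (N * b) := by
    intro s
    rw [add_right_comm, hrL, hrL, hb]; ring
  have hM0 : (M : ℤ) ≠ 0 := by omega
  have hN0 : (N : ℤ) ≠ 0 := by omega
  -- Alternation on the lift: a horizontal step then a vertical one, or the reverse.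
  have hcases : ∀ s : ℤ,
      (γ.row j (s + 1) = γ.row j s ∧ γ.col i (s + 1) = γ.col i s + x (γ.row j s) ∧
        γ.col i (s + 1 + 1) = γ.col i (s + 1) ∧
        γ.row j (s + 1 + 1) = γ.row j (s + 1) + y (γ.col i (s + 1))) ∨
      (γ.col i (s + 1) = γ.col i s ∧ γ.row j (s + 1) = γ.row j s + y (γ.col i s) ∧
        γ.row j (s + 1 + 1) = γ.row j (s + 1) ∧
        γ.col i (s + 1 + 1) = γ.col i (s + 1) + x (γ.row j (s + 1))) := by
    intro s
    have h1 := hs (s + 1)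
    have e1 := hc1 (s + 1)
    have e2 := hr1 (s + 1)
    push_cast at h1 e1 e2
    rcases γ.step_alternates hM hN s with ⟨h, h'⟩ | ⟨h, h'⟩
    · left
      have f1 := h.dx_eq
      have f2 := h'.dy_eq
      rw [hs s] at f1
      rw [h1] at f2
      rw [e1, e2, h'.dx_eq, f2, hc1 s, hr1 s, h.dy_eq, f1]
      simp
    · right
      have f1 := h.dy_eq
      have f2 := h'.dx_eq
      rw [hs s] at f1
      rw [h1] at f2
      rw [e1, e2, h'.dy_eq, f2, hc1 s, hr1 s, h.dx_eq, f1]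
      simp
  refine ⟨{ u := fun s => γ.col i s + γ.col i (s + 1)
            w := fun s => γ.row j s + γ.row j (s + 1)
            period := γ.length
            a := a
            b := b
            period_pos := by exact_mod_cast γ.length_pos
            u_add_period := huL
            w_add_period := hwL
            u_step := ?_, w_step := ?_, height_x := ?_, height_y := ?_, odd := ?_, recur := ?_ },
          ?_, ?_, ?_⟩
  · intro s
    rcases hcases s with ⟨h1, h2, h3, h4⟩ | ⟨h1, h2, h3, h4⟩
    · have := val_eq_one_or x (γ.row j s)
      omega
    · have := val_eq_one_or x (γ.row j (s + 1))
      omega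
  · intro s
    rcases hcases s with ⟨h1, h2, h3, h4⟩ | ⟨h1, h2, h3, h4⟩
    · have := val_eq_one_or y (γ.col i (s + 1))
      omega
    · have := val_eq_one_or y (γ.col i s)
      omega
  · intro s
    rcases hcases s with ⟨h1, h2, h3, h4⟩ | ⟨h1, h2, h3, h4⟩
    · have hy := val_eq_one_or y (γ.col i (s + 1))
      rw [h3, h4, h1]
      have := height_two_mul_add x (γ.row j s) hy
      rw [show γ.row j s + (γ.row j s + (y (γ.col i (s + 1)) : ℤ)) =
        2 * γ.row j s + y (γ.col i (s + 1)) by ring, ← two_mul, this, h2]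
      ring
    · have hy := val_eq_one_or y (γ.col i s)
      rw [h3, h4]
      have := height_two_mul_add x (γ.row j (s + 1)) (e := -y (γ.col i s)) (by omega)
      rw [show γ.row j s + γ.row j (s + 1) = 2 * γ.row j (s + 1) + -y (γ.col i s) by
        rw [h2]; ring, ← two_mul, this, h1]
      ring
  · intro s
    rcases hcases s with ⟨h1, h2, h3, h4⟩ | ⟨h1, h2, h3, h4⟩
    · have hx := val_eq_one_or x (γ.row j s)
      rw [h3, h4]
      have := height_two_mul_add y (γ.col i (s + 1)) (e := -x (γ.row j s)) (by omega)
      rw [show γ.col i s + γ.col i (s + 1) = 2 * γ.col i (s + 1) + -x (γ.row j s) by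
        rw [h2]; ring, ← two_mul, this, h1]
      ring
    · have hx := val_eq_one_or x (γ.row j (s + 1))
      rw [h3, h4, h1]
      have := height_two_mul_add y (γ.col i s) hx
      rw [show γ.col i s + (γ.col i s + (x (γ.row j (s + 1)) : ℤ)) =
        2 * γ.col i s + x (γ.row j (s + 1)) by ring, ← two_mul, this, h2]
      ring
  · intro s
    rcases hcases s with ⟨h1, h2, -, -⟩ | ⟨h1, h2, -, -⟩
    · have := val_eq_one_or x (γ.row j s)
      omega
    · have := val_eq_one_or y (γ.col i s)
      omega
  · intro s s' α β hu hw
    have heq := γ.eq_of_midpoint_eq hM hN hij hu hw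
    -- Here `r` counts the turns of the loop between the two times.
    obtain ⟨r, hr⟩ := (ZMod.intCast_eq_intCast_iff_dvd_sub s s' γ.length).1 heq
    have hur := add_mul_period (u := fun s => γ.col i s + γ.col i (s + 1)) huL s r
    have hwr := add_mul_period (u := fun s => γ.row j s + γ.row j (s + 1)) hwL s r
    rw [show s + r * γ.length = s' by linarith] at hur hwr
    refine ⟨r, ?_, ?_⟩
    · have : (M : ℤ) * α = M * (r * a) := by linarith
      exact mul_left_cancel₀ hM0 this
    · have : (N : ℤ) * β = N * (r * b) := by linarith
      exact mul_left_cancel₀ hN0 this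
  · have hM1 : (M : ℚ) ≠ 0 := by exact_mod_cast hM0
    have hN1 : (N : ℚ) ≠ 0 := by exact_mod_cast hN0
    simp only [homologyClass, ha, hb]
    push_cast
    rw [mul_div_cancel_left₀ _ hM1, mul_div_cancel_left₀ _ hN1]
  · have := hc1 0
    simp only [Int.cast_zero] at this
    change γ.col i 0 + γ.col i (0 + 1) = _
    rw [this]
    simp only [col, cumul_zero]
    ring
  · have := hr1 0
    simp only [Int.cast_zero] at this
    change γ.row j 0 + γ.row j (0 + 1) = _
    rw [this]
    simp only [row, cumul_zero]
    ring

theorem exists_trajectory_homologyClass (hM : 3 ≤ M) (hN : 3 ≤ N) :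
    ∃ T : Trajectory x y, γ.homologyClass = ((T.a : ℚ), (T.b : ℚ)) := by
  obtain ⟨i, hi⟩ := ZMod.intCast_surjective (γ.vert 0).1
  obtain ⟨j, hj⟩ := ZMod.intCast_surjective (γ.vert 0).2
  obtain ⟨T, hT, -⟩ := γ.exists_trajectory hM hN (i := i) (j := j) (by rw [hi, hj])
  exact ⟨T, hT⟩

end Loop
-- The loop through a given edge
/-- The successor of an edge along its loop. The edge is given by its origin and by whether it is
horizontal. -/
def next {M N : ℕ} (x : BinaryString N) (y : BinaryString M) :
    Vertex M N × Bool → Vertex M N × Bool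
  | (v, true) => ((v.1 + ((x v.2 : ℤ) : ZMod M), v.2), false)
  | (v, false) => ((v.1, v.2 + ((y v.1 : ℤ) : ZMod N)), true)

theorem next_injective {M N : ℕ} (x : BinaryString N) (y : BinaryString M) :
    Function.Injective (next x y) := by
  rintro ⟨⟨i, j⟩, b⟩ ⟨⟨i', j'⟩, b'⟩ h
  cases b <;> cases b' <;> simp only [next, Prod.mk.injEq, and_true, Bool.false_eq_true,
    Bool.true_eq_false, and_false] at h ⊢
  · obtain ⟨rfl, h⟩ := h
    exact ⟨rfl, add_right_cancel h⟩
  · obtain ⟨h, rfl⟩ := h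
    exact ⟨add_right_cancel h, rfl⟩

section construction

variable {M N : ℕ} (x : BinaryString N) (y : BinaryString M)

theorem next_cases (hM : 3 ≤ M) (hN : 3 ≤ N) (e : Vertex M N × Bool) :
    (pattern x y).Adj e.1 (next x y e).1 ∧ (next x y e).2 = !e.2 ∧
    (e.2 = true ↔ IsHorizontal e.1 (next x y e).1) ∧
    (e.2 = false ↔ IsVertical e.1 (next x y e).1) := by
  obtain ⟨v, b⟩ := e
  cases b
  · obtain ⟨h1, h2, h3, -⟩ := adj_vertical (x := x) (y := y) hM hN (v := v) rfl
    exact ⟨h1, rfl, by simpa [next] using h2, by simpa [next] using h3⟩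
  · obtain ⟨h1, h2, h3, -⟩ := adj_horizontal (x := x) (y := y) hM hN (v := v) rfl
    exact ⟨h1, rfl, by simpa [next] using h2, by simpa [next] using h3⟩

/-- An injective self-map of a finite set has only periodic points; the orbit over one minimal
period repeats no edge. -/
theorem exists_loop (hM : 3 ≤ M) (hN : 3 ≤ N) (e : Vertex M N × Bool) :
    ∃ γ : Loop x y, γ.vert 0 = e.1 ∧ γ.vert 1 = (next x y e).1 := by
  have : NeZero M := ⟨by omega⟩
  have : NeZero N := ⟨by omega⟩
  set L := Function.minimalPeriod (next x y) e with hL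
  have hpos : 0 < L := Function.minimalPeriod_pos_of_mem_periodicPts
    ((next_injective x y).mem_periodicPts e)
  have : NeZero L := ⟨hpos.ne'⟩
  let orb : ZMod L → Vertex M N × Bool := fun t => (next x y)^[t.val] e
  have horb : ∀ t, orb (t + 1) = next x y (orb t) := by
    intro t
    simp only [orb]
    rw [← Function.iterate_succ_apply' (next x y),
      ← Function.iterate_mod_minimalPeriod_eq (n := t.val + 1),
      ← hL, ZMod.val_add, ZMod.val_one_eq_one_mod, Nat.add_mod_mod]
  have hinj : Function.Injective orb := by
    intro t t' h
    exact ZMod.val_injective L (Function.iterate_injOn_Iio_minimalPeriod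
      (Set.mem_Iio.2 t.val_lt) (Set.mem_Iio.2 t'.val_lt) h)
  have hc := fun t => next_cases x y hM hN (orb t)
  have h0 : orb 0 = e := by simp [orb]
  refine ⟨{ length := L
            length_pos := hpos
            vert := fun t => (orb t).1
            adj := fun t => by rw [horb]; exact (hc t).1
            edges_distinct := ?_
            alternates := ?_ }, ?_, ?_⟩
  · intro t t' h
    simp only [Prod.mk.injEq, horb] at h
    apply hinj
    refine Prod.ext h.1 ?_
    have h1 := (hc t).2.2.1
    have h2 := (hc t').2.2.1
    rw [h.1, h.2, ← h2] at h1
    exact Bool.eq_iff_iff.2 h1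
  · intro t
    have h1 := hc t
    have h2 := hc (t + 1)
    rw [← horb] at h1 h2
    cases hb : (orb t).2
    · right
      exact ⟨h1.2.2.2.1 hb, h2.2.2.1.1 (by rw [h1.2.1, hb]; rfl)⟩
    · left
      exact ⟨h1.2.2.1.1 hb, h2.2.2.2.1 (by rw [h1.2.1, hb]; rfl)⟩
  · simp only [h0]
  · have := horb 0
    rw [zero_add] at this
    simp only [this, h0]

end construction

/-! ### Reflections of patterns -/

section swap

variable {M N : ℕ} {x : BinaryString N} {y : BinaryString M}

theorem isRight_swap {v w : Vertex M N} : IsRight v.swap w.swap ↔ IsUp v w := by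
  simp [IsRight, IsUp, Prod.ext_iff, and_comm]

theorem isLeft_swap {v w : Vertex M N} : IsLeft v.swap w.swap ↔ IsDown v w := by
  simp [IsLeft, IsDown, Prod.ext_iff, and_comm]

theorem isUp_swap {v w : Vertex M N} : IsUp v.swap w.swap ↔ IsRight v w := by
  simp [IsRight, IsUp, Prod.ext_iff, and_comm]

theorem isDown_swap {v w : Vertex M N} : IsDown v.swap w.swap ↔ IsLeft v w := by
  simp [IsLeft, IsDown, Prod.ext_iff, and_comm]

/-- The image of a loop under the reflection in the diagonal. -/
def Loop.swap (γ : Loop x y) : Loop y x where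
  length := γ.length
  length_pos := γ.length_pos
  vert t := (γ.vert t).swap
  adj t := by
    have := γ.adj t
    simp only [pattern, isRight_swap, isLeft_swap, isUp_swap, isDown_swap, Prod.fst_swap,
      Prod.snd_swap] at this ⊢
    tauto
  edges_distinct := by
    intro t t' h
    simp only [Prod.mk.injEq, Prod.swap_inj] at h
    exact γ.edges_distinct (Prod.ext h.1 h.2)
  alternates t := by
    have := γ.alternates t
    simp only [IsHorizontal, IsVertical, isRight_swap, isLeft_swap, isUp_swap,
      isDown_swap] at this ⊢
    tauto

theorem Loop.homologyClass_swap (γ : Loop x y) :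
    γ.swap.homologyClass = γ.homologyClass.swap := by
  simp only [homologyClass, xShift, yShift, swap, isRight_swap, isLeft_swap, isUp_swap,
    isDown_swap]
  rfl

theorem nontrivialClasses_swap : nontrivialClasses y x = Prod.swap '' nontrivialClasses x y := by
  have key : ∀ {M N : ℕ} {x : BinaryString N} {y : BinaryString M} {c : ℚ × ℚ},
      c ∈ nontrivialClasses x y → c.swap ∈ nontrivialClasses y x := by
    rintro M N x y c ⟨γ, hγ, rfl⟩
    refine ⟨γ.swap, fun h0 => hγ ?_, γ.homologyClass_swap⟩
    rw [γ.homologyClass_swap] at h0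
    exact Prod.swap_injective h0
  ext c
  rw [Set.image_swap_eq_preimage_swap, Set.mem_preimage]
  exact ⟨key, fun h => by simpa using key h⟩

/-- The reflection in a vertical line. -/
def mirror (v : Vertex M N) : Vertex M N := (-v.1, v.2)

theorem mirror_injective : Function.Injective (mirror (M := M) (N := N)) := by
  rintro ⟨i, j⟩ ⟨i', j'⟩ h
  simpa [mirror] using h

theorem isRight_mirror {v w : Vertex M N} : IsRight (mirror v) (mirror w) ↔ IsLeft v w := by
  simp only [IsRight, IsLeft, mirror, Prod.ext_iff]
  exact and_congr ⟨fun h => by linear_combination h, fun h => by linear_combination h⟩ eq_comm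

theorem isLeft_mirror {v w : Vertex M N} : IsLeft (mirror v) (mirror w) ↔ IsRight v w := by
  simp only [IsRight, IsLeft, mirror, Prod.ext_iff]
  exact and_congr ⟨fun h => by linear_combination h, fun h => by linear_combination h⟩ eq_comm

theorem isUp_mirror {v w : Vertex M N} : IsUp (mirror v) (mirror w) ↔ IsUp v w := by
  simp [IsUp, mirror, Prod.ext_iff]

theorem isDown_mirror {v w : Vertex M N} : IsDown (mirror v) (mirror w) ↔ IsDown v w := by
  simp [IsDown, mirror, Prod.ext_iff]

/-- The image of a loop under the reflection in a vertical line. -/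
def Loop.reflect (γ : Loop x y) : Loop (-x) (fun i => y (-i)) where
  length := γ.length
  length_pos := γ.length_pos
  vert t := mirror (γ.vert t)
  adj t := by
    have := γ.adj t
    simp only [pattern, isRight_mirror, isLeft_mirror, isUp_mirror, isDown_mirror] at this ⊢
    simp only [mirror, Pi.neg_apply, neg_neg, neg_eq_iff_eq_neg]
    tauto
  edges_distinct := by
    intro t t' h
    simp only [Prod.mk.injEq] at h
    exact γ.edges_distinct (Prod.ext (mirror_injective h.1) (mirror_injective h.2))
  alternates t := by
    have := γ.alternates t
    simp only [IsHorizontal, IsVertical, isRight_mirror, isLeft_mirror, isUp_mirror,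
      isDown_mirror] at this ⊢
    tauto

theorem Loop.homologyClass_reflect (γ : Loop x y) :
    γ.reflect.homologyClass = (-γ.homologyClass.1, γ.homologyClass.2) := by
  simp only [homologyClass, xShift, yShift, reflect, isRight_mirror, isLeft_mirror, isUp_mirror,
    isDown_mirror]
  push_cast
  rw [← neg_div, neg_sub]
  rfl

theorem Loop.nontrivial_reflect {γ : Loop x y} : γ.reflect.Nontrivial ↔ γ.Nontrivial := by
  simp [Loop.Nontrivial, homologyClass_reflect, Prod.ext_iff]

theorem k_neg [NeZero N] (x : BinaryString N) : k (-x) = -k x := by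
  simp [k_eq_sum]

theorem k_comp_neg [NeZero M] (y : BinaryString M) : k (fun i => y (-i)) = k y := by
  rw [k_eq_sum, k_eq_sum]
  exact Equiv.sum_comp (Equiv.neg (ZMod M)) fun i => (y i : ℤ)

end swap
-- Determination of the classes
section classes

variable {M N : ℕ} {x : BinaryString N} {y : BinaryString M}

theorem nontrivialClasses_reflect :
    nontrivialClasses x y =
      (fun c => (-c.1, c.2)) '' nontrivialClasses (-x) (fun i => y (-i)) := by
  have key : ∀ {x : BinaryString N} {y : BinaryString M} {c : ℚ × ℚ},
      c ∈ nontrivialClasses x y → (-c.1, c.2) ∈ nontrivialClasses (-x) (fun i => y (-i)) := by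
    rintro x y c ⟨γ, hγ, rfl⟩
    exact ⟨γ.reflect, Loop.nontrivial_reflect.2 hγ, γ.homologyClass_reflect⟩
  ext c
  constructor
  · exact fun h => ⟨_, key h, by simp⟩
  · rintro ⟨d, hd, rfl⟩
    simpa using key hd

theorem nontrivialClasses_of_pos (hM : 3 ≤ M) (hN : 3 ≤ N) (hx : 0 < k x) (hy : 0 < k y) :
    nontrivialClasses x y =
      {((k x : ℚ) / (Int.gcd (k x) (k y) : ℚ), (k y : ℚ) / (Int.gcd (k x) (k y) : ℚ))} := by
  have : NeZero M := ⟨by omega⟩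
  have : NeZero N := ⟨by omega⟩
  refine (Set.Nonempty.subset_singleton_iff ?_).1 ?_
  rotate_left
  · rintro c ⟨γ, hγ, rfl⟩
    obtain ⟨T, hT⟩ := γ.exists_trajectory_homologyClass hM hN
    rw [Loop.Nontrivial, hT] at hγ
    obtain ⟨h1, h2⟩ := T.mul_gcd_eq hx hy (by
      by_contra! h
      exact hγ (by simp [h]))
    have hg : ((Int.gcd (k x) (k y) : ℕ) : ℚ) ≠ 0 := by
      exact_mod_cast (Int.gcd_pos_of_ne_zero_left _ hx.ne').ne'
    rw [hT, Set.mem_singleton_iff, Prod.mk.injEq, eq_div_iff hg, eq_div_iff hg]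
    exact ⟨by exact_mod_cast h1, by exact_mod_cast h2⟩
  -- The levels 1 and 0 make `q` even and `p` odd, so that the corner is the midpoint of a
  -- horizontal edge, and the last passage forces it to point right.
  · obtain ⟨q, hq, hq'⟩ := exists_height_eq_last hx 1
    obtain ⟨p, hp, hp'⟩ := exists_height_eq_last hy 0
    have h1 := height_add_emod_two x q
    have h2 := height_add_emod_two y p
    obtain ⟨j, rfl⟩ : ∃ j, q = 2 * j := ⟨q / 2, by omega⟩
    obtain ⟨i, rfl⟩ : ∃ i, p = 2 * i + 1 := ⟨p / 2, by omega⟩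
    have hxj : (x j : ℤ) = 1 := by
      have h3 := hq' (2 * j + 1) (by omega)
      have h4 := val_eq_one_or x j
      rw [height_two_mul_add_one] at h3
      omega
    obtain ⟨γ, h3, h4⟩ := exists_loop x y hM hN (((i : ZMod M), (j : ZMod N)), true)
    obtain ⟨T, hT, hu, hw⟩ := γ.exists_trajectory hM hN h3
    obtain ⟨-, -, -, h5, h6⟩ := adj_horizontal (x := x) (y := y) hM hN
      (v := γ.vert 0) (w := γ.vert (0 + 1)) (by rw [zero_add, h4, h3]; rfl)
    have h7 : T.u 0 = 2 * i + 1 := by rw [hu, Loop.dx, h5, h3, hxj]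
    have h8 : T.w 0 = 2 * j := by rw [hw, Loop.dy, h6, add_zero]
    have h9 := T.ne_zero_of_eq_corner ⟨by rwa [hp], by rwa [hq]⟩ h7 h8
    refine ⟨_, γ, fun h0 => ?_, rfl⟩
    rw [hT, Prod.mk.injEq, Int.cast_eq_zero, Int.cast_eq_zero] at h0
    omega

theorem nontrivialClasses_of_ne_zero (hM : 3 ≤ M) (hN : 3 ≤ N) (hx : k x ≠ 0) (hy : k y ≠ 0) :
    nontrivialClasses x y =
      {((k x : ℚ) / (Int.gcd (k x) (k y) : ℚ), (k y : ℚ) / (Int.gcd (k x) (k y) : ℚ))} := by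
  have : NeZero M := ⟨by omega⟩
  have : NeZero N := ⟨by omega⟩
  have key : ∀ {M N : ℕ} {x : BinaryString N} {y : BinaryString M}, 3 ≤ M → 3 ≤ N → k x ≠ 0 →
      0 < k y → nontrivialClasses x y =
        {((k x : ℚ) / (Int.gcd (k x) (k y) : ℚ), (k y : ℚ) / (Int.gcd (k x) (k y) : ℚ))} := by
    intro M N x y hM hN hx hy
    have : NeZero M := ⟨by omega⟩
    have : NeZero N := ⟨by omega⟩
    rcases lt_or_gt_of_ne hx with h | h
    · rw [nontrivialClasses_reflect, nontrivialClasses_of_pos hM hN (by rw [k_neg]; omega)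
        (by rwa [k_comp_neg]), k_neg, k_comp_neg]
      simp [neg_div]
    · exact nontrivialClasses_of_pos hM hN h hy
  rcases lt_or_gt_of_ne hy with h | h
  -- Conjugated by the swap, the reflection changes the sign of `k y` instead.
  · rw [nontrivialClasses_swap, nontrivialClasses_reflect, nontrivialClasses_swap,
      key hM hN (by rwa [k_comp_neg]) (by rw [k_neg]; omega), k_neg, k_comp_neg]
    simp [neg_div, Int.gcd_comm]
  · exact key hM hN hx h

theorem Loop.homologyClass_of_fst_ne_zero (hM : 3 ≤ M) (hN : 3 ≤ N) (hy : k y = 0) (γ : Loop x y)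
    (hγ : γ.homologyClass.1 ≠ 0) : γ.homologyClass = (1, 0) ∨ γ.homologyClass = (-1, 0) := by
  have : NeZero M := ⟨by omega⟩
  have : NeZero N := ⟨by omega⟩
  have key : ∀ {x : BinaryString N} {y : BinaryString M} (γ : Loop x y), k y = 0 →
      0 < γ.homologyClass.1 → γ.homologyClass = (1, 0) := by
    intro x y γ hy hγ
    obtain ⟨T, hT⟩ := γ.exists_trajectory_homologyClass hM hN
    rw [hT] at hγ ⊢
    obtain ⟨h1, h2⟩ := T.eq_one_and_eq_zero hy (Int.cast_pos.1 hγ)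
    simp [h1, h2]
  rcases lt_or_gt_of_ne hγ with h | h
  · right
    have h' := key γ.reflect (by rwa [k_comp_neg]) (by rw [γ.homologyClass_reflect]; simpa using h)
    rw [γ.homologyClass_reflect, Prod.mk.injEq, neg_eq_iff_eq_neg] at h'
    exact Prod.ext h'.1 h'.2
  · exact .inl (key γ hy h)

theorem Loop.homologyClass_of_snd_ne_zero (hM : 3 ≤ M) (hN : 3 ≤ N) (hx : k x = 0) (γ : Loop x y)
    (hγ : γ.homologyClass.2 ≠ 0) : γ.homologyClass = (0, 1) ∨ γ.homologyClass = (0, -1) := by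
  have h := γ.swap.homologyClass_of_fst_ne_zero hN hM hx (by rwa [γ.homologyClass_swap])
  rw [γ.homologyClass_swap] at h
  exact h.imp (fun h => Prod.swap_injective h) (fun h => Prod.swap_injective h)

theorem Loop.Nontrivial.fst_or_snd {γ : Loop x y} (hγ : γ.Nontrivial) :
    γ.homologyClass.1 ≠ 0 ∨ γ.homologyClass.2 ≠ 0 := by
  by_contra! h
  exact hγ (Prod.ext h.1 h.2)

theorem nontrivialClasses_subset_of_y (hM : 3 ≤ M) (hN : 3 ≤ N) (hx : k x ≠ 0) (hy : k y = 0) :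
    nontrivialClasses x y ⊆ {(1, 0), (-1, 0)} := by
  have : NeZero M := ⟨by omega⟩
  have : NeZero N := ⟨by omega⟩
  rintro c ⟨γ, hγ, rfl⟩
  refine γ.homologyClass_of_fst_ne_zero hM hN hy (hγ.fst_or_snd.resolve_right ?_)
  obtain ⟨T, hT⟩ := γ.exists_trajectory_homologyClass hM hN
  have h := T.k_mul_eq
  rw [hy, zero_mul, eq_comm, mul_eq_zero] at h
  simp [hT, h.resolve_left hx]

theorem nontrivialClasses_subset_of_x (hM : 3 ≤ M) (hN : 3 ≤ N) (hx : k x = 0) (hy : k y ≠ 0) :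
    nontrivialClasses x y ⊆ {(0, 1), (0, -1)} := by
  rw [nontrivialClasses_swap]
  refine (Set.image_mono (nontrivialClasses_subset_of_y hN hM hy hx)).trans ?_
  simp [Set.image_pair]

theorem nontrivialClasses_subset_of_both (hM : 3 ≤ M) (hN : 3 ≤ N) (hx : k x = 0) (hy : k y = 0) :
    nontrivialClasses x y ⊆ {(0, 1), (0, -1), (1, 0), (-1, 0)} := by
  rintro c ⟨γ, hγ, rfl⟩
  rcases hγ.fst_or_snd with h | h
  · rcases γ.homologyClass_of_fst_ne_zero hM hN hy h with h | h <;> simp [h]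
  · rcases γ.homologyClass_of_snd_ne_zero hM hN hx h with h | h <;> simp [h]

/-- If both walks close up, horizontal and vertical nontrivial loops do not coexist. -/
theorem Loop.snd_eq_zero_of_fst_ne_zero (hM : 3 ≤ M) (hN : 3 ≤ N) (hx : k x = 0) (hy : k y = 0)
    (γ γ' : Loop x y) (hγ : γ.homologyClass.1 ≠ 0) : γ'.homologyClass.2 = 0 := by
  have : NeZero M := ⟨by omega⟩
  have : NeZero N := ⟨by omega⟩
  obtain ⟨p, hp⟩ := exists_height_max hy
  obtain ⟨p', hp'⟩ := exists_height_min hy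
  obtain ⟨q, hq⟩ := exists_height_max hx
  obtain ⟨q', hq'⟩ := exists_height_min hx
  obtain ⟨T, hT⟩ := γ.exists_trajectory_homologyClass hM hN
  obtain ⟨T', hT'⟩ := γ'.swap.exists_trajectory_homologyClass hN hM
  -- The loop `γ` makes the oscillation of `height x` the larger one; a vertical component of `γ'`
  -- would make it the smaller one.
  have h1 := T.oscillation_lt (p' := p') (by simpa [hT] using hγ) hp hq hq'
  have h2 : T'.a = 0 := by
    by_contra h
    have := T'.oscillation_lt (p' := q') h hq hp hp'
    omega
  rw [γ'.homologyClass_swap] at hT'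
  have h3 := congrArg Prod.fst hT'
  simpa [h2] using h3

end classes

/-! ### Symmetric patterns -/

section symmetric

variable {N : ℕ} {x : BinaryString N}

/-- A loop and its image under the swap live in the same pattern and have exchanged components,
which zero drift forbids. -/
theorem Loop.k_ne_zero_of_nontrivial (hN : 3 ≤ N) {γ : Loop x x} (hγ : γ.Nontrivial) :
    k x ≠ 0 := by
  intro hk
  have h1 := γ.snd_eq_zero_of_fst_ne_zero hN hN hk hk γ.swap
  have h2 := γ.swap.snd_eq_zero_of_fst_ne_zero hN hN hk hk γ
  rw [γ.homologyClass_swap] at h1 h2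
  rcases hγ.fst_or_snd with h | h
  · exact h (h1 h)
  · exact h (h2 h)

theorem Loop.homologyClass_of_symmetric (hN : 3 ≤ N) {γ : Loop x x} (hγ : γ.Nontrivial) :
    (0 < k x → γ.homologyClass = (1, 1)) ∧ (k x < 0 → γ.homologyClass = (-1, -1)) ∧ k x ≠ 0 := by
  have hk := Loop.k_ne_zero_of_nontrivial hN hγ
  have h : γ.homologyClass ∈ nontrivialClasses x x := ⟨γ, hγ, rfl⟩
  have hk' : (k x : ℚ) ≠ 0 := by exact_mod_cast hk
  rw [nontrivialClasses_of_ne_zero hN hN hk hk, Set.mem_singleton_iff, Int.gcd_self,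
    Nat.cast_natAbs, Int.cast_abs] at h
  refine ⟨fun hpos => ?_, fun hneg => ?_, hk⟩
  · have : (0 : ℚ) < k x := by exact_mod_cast hpos
    rw [h, abs_of_pos this, div_self hk']
  · have : (k x : ℚ) < 0 := by exact_mod_cast hneg
    rw [h, abs_of_neg this, div_neg, div_self hk']

end symmetric

/-! ### Patterns realizing the classes -/

section examples

instance {M N : ℕ} (v w : Vertex M N) : Decidable (IsRight v w) :=
  inferInstanceAs (Decidable (w = _))

instance {M N : ℕ} (v w : Vertex M N) : Decidable (IsLeft v w) :=
  inferInstanceAs (Decidable (v = _))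

instance {M N : ℕ} (v w : Vertex M N) : Decidable (IsUp v w) :=
  inferInstanceAs (Decidable (w = _))

instance {M N : ℕ} (v w : Vertex M N) : Decidable (IsDown v w) :=
  inferInstanceAs (Decidable (v = _))

instance {M N : ℕ} (v w : Vertex M N) : Decidable (IsHorizontal v w) :=
  inferInstanceAs (Decidable (_ ∨ _))

instance {M N : ℕ} (v w : Vertex M N) : Decidable (IsVertical v w) :=
  inferInstanceAs (Decidable (_ ∨ _))

instance {M N : ℕ} (x : BinaryString N) (y : BinaryString M) (v w : Vertex M N) :
    Decidable ((pattern x y).Adj v w) :=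
  inferInstanceAs (Decidable (_ ∨ _ ∨ _ ∨ _))

theorem Loop.xShift_eq_card {M N : ℕ} {x : BinaryString N} {y : BinaryString M} (γ : Loop x y) :
    γ.xShift = (Finset.univ.filter fun t => IsRight (γ.vert t) (γ.vert (t + 1))).card -
      (Finset.univ.filter fun t => IsLeft (γ.vert t) (γ.vert (t + 1))).card := by
  rw [xShift, Set.ncard_eq_toFinset_card', Set.ncard_eq_toFinset_card', Set.toFinset_ofPred,
    Set.toFinset_ofPred]

theorem Loop.yShift_eq_card {M N : ℕ} {x : BinaryString N} {y : BinaryString M} (γ : Loop x y) :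
    γ.yShift = (Finset.univ.filter fun t => IsUp (γ.vert t) (γ.vert (t + 1))).card -
      (Finset.univ.filter fun t => IsDown (γ.vert t) (γ.vert (t + 1))).card := by
  rw [yShift, Set.ncard_eq_toFinset_card', Set.ncard_eq_toFinset_card', Set.toFinset_ofPred,
    Set.toFinset_ofPred]

/-- The string `+-+-`. -/
def alternating : BinaryString 4 := (![1, -1, 1, -1] : Fin 4 → ℤˣ)

/-- The string `++--`. -/
def twoBlocks : BinaryString 4 := (![1, 1, -1, -1] : Fin 4 → ℤˣ)

/-- The string `++--+`. -/
def threeBlocks : BinaryString 5 := (![1, 1, -1, -1, 1] : Fin 5 → ℤˣ)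

theorem k_alternating : k alternating = 0 := by rw [k_eq_sum]; decide

theorem k_twoBlocks : k twoBlocks = 0 := by rw [k_eq_sum]; decide

theorem k_threeBlocks : k threeBlocks = 1 := by rw [k_eq_sum]; decide

/-- The vertices of a staircase between the columns `0` and `1`. -/
def upStaircase (M : ℕ) : ZMod 8 → Vertex M 4 :=
  (![(0, 0), (1, 0), (1, 1), (0, 1), (0, 2), (1, 2), (1, 3), (0, 3)] : Fin 8 → Vertex M 4)

/-- The vertices of a staircase between the columns `2` and `3`. -/
def downStaircase (M : ℕ) : ZMod 8 → Vertex M 4 :=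
  (![(2, 0), (3, 0), (3, 3), (2, 3), (2, 2), (3, 2), (3, 1), (2, 1)] : Fin 8 → Vertex M 4)

/-- Columns 0 and 1 both point up and the alternating rows lead back and forth between them. -/
def upLoopTwoBlocks : Loop alternating twoBlocks where
  length := 8
  length_pos := by norm_num
  vert := upStaircase 4
  adj := by decide
  edges_distinct := by decide
  alternates := by decide

def downLoopTwoBlocks : Loop alternating twoBlocks where
  length := 8
  length_pos := by norm_num
  vert := downStaircase 4
  adj := by decide
  edges_distinct := by decide
  alternates := by decide

def upLoopThreeBlocks : Loop alternating threeBlocks where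
  length := 8
  length_pos := by norm_num
  vert := upStaircase 5
  adj := by decide
  edges_distinct := by decide
  alternates := by decide

def downLoopThreeBlocks : Loop alternating threeBlocks where
  length := 8
  length_pos := by norm_num
  vert := downStaircase 5
  adj := by decide
  edges_distinct := by decide
  alternates := by decide

theorem homologyClass_upLoopTwoBlocks : upLoopTwoBlocks.homologyClass = (0, 1) := by
  have hx : upLoopTwoBlocks.xShift = 0 := by rw [Loop.xShift_eq_card]; decide
  have hy : upLoopTwoBlocks.yShift = 4 := by rw [Loop.yShift_eq_card]; decide
  rw [Loop.homologyClass, hx, hy]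
  norm_num

theorem homologyClass_downLoopTwoBlocks : downLoopTwoBlocks.homologyClass = (0, -1) := by
  have hx : downLoopTwoBlocks.xShift = 0 := by rw [Loop.xShift_eq_card]; decide
  have hy : downLoopTwoBlocks.yShift = -4 := by rw [Loop.yShift_eq_card]; decide
  rw [Loop.homologyClass, hx, hy]
  norm_num

theorem homologyClass_upLoopThreeBlocks : upLoopThreeBlocks.homologyClass = (0, 1) := by
  have hx : upLoopThreeBlocks.xShift = 0 := by rw [Loop.xShift_eq_card]; decide
  have hy : upLoopThreeBlocks.yShift = 4 := by rw [Loop.yShift_eq_card]; decide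
  rw [Loop.homologyClass, hx, hy]
  norm_num

theorem homologyClass_downLoopThreeBlocks : downLoopThreeBlocks.homologyClass = (0, -1) := by
  have hx : downLoopThreeBlocks.xShift = 0 := by rw [Loop.xShift_eq_card]; decide
  have hy : downLoopThreeBlocks.yShift = -4 := by rw [Loop.yShift_eq_card]; decide
  rw [Loop.homologyClass, hx, hy]
  norm_num

theorem mem_nontrivialClasses {M N : ℕ} {x : BinaryString N} {y : BinaryString M} (γ : Loop x y)
    {c : ℚ × ℚ} (h : γ.homologyClass = c) (hc : c ≠ (0, 0)) : c ∈ nontrivialClasses x y :=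
  ⟨γ, by rwa [Loop.Nontrivial, h], h⟩

theorem nontrivialClasses_threeBlocks :
    nontrivialClasses alternating threeBlocks = {(0, 1), (0, -1)} := by
  apply Set.Subset.antisymm
  · exact nontrivialClasses_subset_of_x (by norm_num) (by norm_num) k_alternating
      (by rw [k_threeBlocks]; exact one_ne_zero)
  · rintro c (rfl | rfl)
    · exact mem_nontrivialClasses _ homologyClass_upLoopThreeBlocks (by simp)
    · exact mem_nontrivialClasses _ homologyClass_downLoopThreeBlocks (by simp)

/-- The drifts alone leave four classes; the explicit vertical loop excludes the horizontal ones. -/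
theorem nontrivialClasses_twoBlocks :
    nontrivialClasses alternating twoBlocks = {(0, 1), (0, -1)} := by
  apply Set.Subset.antisymm
  · rintro c ⟨γ, hγ, rfl⟩
    refine γ.homologyClass_of_snd_ne_zero (by norm_num) (by norm_num) k_alternating
      (hγ.fst_or_snd.resolve_left fun h => ?_)
    have := γ.snd_eq_zero_of_fst_ne_zero (by norm_num) (by norm_num) k_alternating k_twoBlocks
      upLoopTwoBlocks h
    rw [homologyClass_upLoopTwoBlocks] at this
    exact one_ne_zero this
  · rintro c (rfl | rfl)
    · exact mem_nontrivialClasses _ homologyClass_upLoopTwoBlocks (by simp)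
    · exact mem_nontrivialClasses _ homologyClass_downLoopTwoBlocks (by simp)

end examples

end Hitomezashi

theorem theorem1 :
    -- symmetric patterns
    (∀ (N : ℕ) (_ : 3 ≤ N) (x : BinaryString N) (γ : Loop x x), γ.Nontrivial →
      (0 < k x → γ.homologyClass = (1, 1)) ∧
      (k x < 0 → γ.homologyClass = (-1, -1)) ∧
      k x ≠ 0) ∧
    -- general patterns
    (∀ (M N : ℕ) (_ : 3 ≤ M) (_ : 3 ≤ N) (x : BinaryString N) (y : BinaryString M),
      (k x ≠ 0 → k y ≠ 0 →
        nontrivialClasses x y =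
          {((k x : ℚ) / (Int.gcd (k x) (k y) : ℚ), (k y : ℚ) / (Int.gcd (k x) (k y) : ℚ))}) ∧
      (k x = 0 → k y ≠ 0 → nontrivialClasses x y ⊆ {(0, 1), (0, -1)}) ∧
      (k x ≠ 0 → k y = 0 → nontrivialClasses x y ⊆ {(1, 0), (-1, 0)}) ∧
      (k x = 0 → k y = 0 → nontrivialClasses x y ⊆ {(0, 1), (0, -1), (1, 0), (-1, 0)})) ∧
    -- every class allowed in the last three cases does occur
    (∃ (M N : ℕ) (_ : 3 ≤ M) (_ : 3 ≤ N) (x : BinaryString N) (y : BinaryString M),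
      k x = 0 ∧ k y ≠ 0 ∧ nontrivialClasses x y = {(0, 1), (0, -1)}) ∧
    (∃ (M N : ℕ) (_ : 3 ≤ M) (_ : 3 ≤ N) (x : BinaryString N) (y : BinaryString M),
      k x ≠ 0 ∧ k y = 0 ∧ nontrivialClasses x y = {(1, 0), (-1, 0)}) ∧
    (∃ (M N : ℕ) (_ : 3 ≤ M) (_ : 3 ≤ N) (x : BinaryString N) (y : BinaryString M),
      k x = 0 ∧ k y = 0 ∧ nontrivialClasses x y = {(0, 1), (0, -1)}) ∧
    (∃ (M N : ℕ) (_ : 3 ≤ M) (_ : 3 ≤ N) (x : BinaryString N) (y : BinaryString M),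
      k x = 0 ∧ k y = 0 ∧ nontrivialClasses x y = {(1, 0), (-1, 0)}) := by
  have three : 3 ≤ 4 := by norm_num
  have three' : 3 ≤ 5 := by norm_num
  have hk : k threeBlocks ≠ 0 := by rw [k_threeBlocks]; exact one_ne_zero
  refine ⟨fun N hN x γ hγ => γ.homologyClass_of_symmetric hN hγ, fun M N hM hN x y =>
    ⟨nontrivialClasses_of_ne_zero hM hN, nontrivialClasses_subset_of_x hM hN,
      nontrivialClasses_subset_of_y hM hN, nontrivialClasses_subset_of_both hM hN⟩,
    ⟨5, 4, three', three, _, _, k_alternating, hk, nontrivialClasses_threeBlocks⟩,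
    ⟨4, 5, three, three', threeBlocks, alternating, hk, k_alternating, ?_⟩,
    ⟨4, 4, three, three, _, _, k_alternating, k_twoBlocks, nontrivialClasses_twoBlocks⟩,
    ⟨4, 4, three, three, twoBlocks, alternating, k_twoBlocks, k_alternating, ?_⟩⟩
  · rw [nontrivialClasses_swap, nontrivialClasses_threeBlocks]
    simp [Set.image_pair]
  · rw [nontrivialClasses_swap, nontrivialClasses_twoBlocks]
    simp [Set.image_pair]
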